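/- Let $E$ be a real Banach lattice. A sequence $(x_n)$ in $E$ is disjoint if $|x_m|\wedge|x_n|=0$ for $m\neq n$. A set $A\subseteq E$ is an \emph{Lwc set} if every disjoint sequence in its solid hull $\bigcup_{a\in A}[-|a|,|a|]$ converges to $0$ in norm. A bounded set $A\subseteq E$ is \emph{limited} if every weak$^*$-null sequence in the norm dual $E'$ converges to $0$ uniformly on $A$. A bounded linear operator $T:E\to E$ is \emph{l-Lwc} if it maps limited sets onto Lwc sets, and \emph{l-Mwc} if $Tx_n\to 0$ weakly for every disjoint bounded sequence $(x_n)$ in $E$. Let $\mathrm{L}_r(E)$ be the algebra of regular operators on $E$ (differences of two positive bounded operators), ordered by $S\le T$ iff $Sx\le Tx$ for all $x\geq 0$, with the regular norm $\|T\|_r=\inf\{\|S\|: S \text{ a bounded operator on } E,\ \pm T\le S\}$. Let $\text{r-l-Lwc}(E)$ (resp. $\text{r-l-Mwc}(E)$) be the set of all operators $T_1-T_2$ with $T_1,T_2$ positive l-Lwc (resp. positive l-Mwc) operators on $E$, and let $I_E$ be the identity operator. Then: (i) $\text{r-l-Lwc}(E)$ and $\text{r-l-Mwc}(E)$ are (not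 necessarily unital) subalgebras of $\mathrm{L}_r(E)$. Moreover, $$\text{r-l-Lwc}(E)=\mathrm{L}_r(E)\iff I_E \text{ is l-Lwc},\qquad \text{r-l-Mwc}(E)=\mathrm{L}_r(E)\iff I_E\text{ is l-Mwc}.$$ (ii) If $E$ is Dedekind complete (every non-empty subset that is bounded above has a supremum), then $(\mathrm{L}_r(E),\|\cdot\|_r)$ is a Banach lattice, and $\text{r-l-Lwc}(E)$ and $\text{r-l-Mwc}(E)$ are closed order ideals in it (norm-closed vector subspaces $I$ such that $|S|\le|T|$ and $T\in I$ imply $S\in I$). -/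

import Mathlib

open Filter Topology

/-! ### Disjointness, Dedekind completeness, L-weakly compact sets and limited sets -/

/-- A sequence in a vector lattice is disjoint if `|x m| ∧ |x n| = 0` for `m ≠ n`. -/
def IsDisjointSeq {F : Type*} [Lattice F] [AddCommGroup F] (x : ℕ → F) : Prop :=
  ∀ m n, m ≠ n → |x m| ⊓ |x n| = 0

/-- Every non-empty subset that is bounded above has a supremum. -/
def IsDedekindComplete (E : Type*) [Lattice E] : Prop :=
  ∀ s : Set E, s.Nonempty → BddAbove s → ∃ a, IsLUB s a

/-- An Lwc set: each disjoint sequence in its solid hull is norm-null. -/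
def IsLwcSet {F : Type*} [NormedAddCommGroup F] [Lattice F] (A : Set F) : Prop :=
  ∀ x : ℕ → F, (∀ n, x n ∈ LatticeOrderedAddCommGroup.solidClosure A) → IsDisjointSeq x →
    Tendsto x atTop (𝓝 0)

/-- A limited set: a bounded set on which every weak-star null sequence of the dual is
uniformly null. -/
def IsLimitedSet {X : Type*} [NormedAddCommGroup X] [NormedSpace ℝ X] (A : Set X) : Prop :=
  Bornology.IsBounded A ∧
    ∀ f : ℕ → WeakDual ℝ X, Tendsto f atTop (𝓝 0) →
      TendstoUniformlyOn (fun n x => f n x) (fun _ => (0 : ℝ)) atTop A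

/-! ### Classes of operators -/

/-- `T` is an l-Lwc (limitedly L-weakly compact) operator. -/
def IsLLwc {X F : Type*} [NormedAddCommGroup X] [NormedSpace ℝ X]
    [NormedAddCommGroup F] [NormedSpace ℝ F] [Lattice F] (T : X →L[ℝ] F) : Prop :=
  ∀ A : Set X, IsLimitedSet A → IsLwcSet (T '' A)

/-- `T` is an l-Mwc (limitedly M-weakly compact) operator: `T x n → 0` weakly for every disjoint
bounded sequence `x`. -/
def IsLMwc {E Y : Type*} [NormedAddCommGroup E] [NormedSpace ℝ E] [Lattice E]
    [NormedAddCommGroup Y] [NormedSpace ℝ Y] (T : E →L[ℝ] Y) : Prop :=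
  ∀ x : ℕ → E, IsDisjointSeq x → Bornology.IsBounded (Set.range x) →
    Tendsto (fun n => toWeakSpace ℝ Y (T (x n))) atTop (𝓝 0)

/-- Positive operators. -/
def IsPositiveOp {E F : Type*} [NormedAddCommGroup E] [NormedSpace ℝ E] [Lattice E]
    [NormedAddCommGroup F] [NormedSpace ℝ F] [Lattice F] (T : E →L[ℝ] F) : Prop :=
  ∀ x, 0 ≤ x → 0 ≤ T x

/-- The r-`P`-operators: differences of two positive operators belonging to `P`. -/
def IsRegularIn {E F : Type*} [NormedAddCommGroup E] [NormedSpace ℝ E] [Lattice E]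
    [NormedAddCommGroup F] [NormedSpace ℝ F] [Lattice F] (P : Set (E →L[ℝ] F))
    (T : E →L[ℝ] F) : Prop :=
  ∃ T₁ ∈ P, ∃ T₂ ∈ P, IsPositiveOp T₁ ∧ IsPositiveOp T₂ ∧ T = T₁ - T₂

/-! ### The algebra of regular operators, its order, and the regular norm -/

section Regular

variable (E : Type*) [NormedAddCommGroup E] [NormedSpace ℝ E] [Lattice E]
  [IsOrderedAddMonoid E] [IsOrderedModule ℝ E]

/-- The regular operators on `E` form a unital subalgebra of the algebra of bounded operators. -/
def regularSubalgebra : Subalgebra ℝ (E →L[ℝ] E) where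
  carrier := {T | IsRegularIn Set.univ T}
  mul_mem' := by
    rintro _ _ ⟨A, -, B, -, hA, hB, rfl⟩ ⟨C, -, D, -, hC, hD, rfl⟩
    refine ⟨A * C + B * D, trivial, A * D + B * C, trivial, ?_, ?_, ?_⟩
    · exact fun x hx => add_nonneg (hA _ (hC x hx)) (hB _ (hD x hx))
    · exact fun x hx => add_nonneg (hA _ (hD x hx)) (hB _ (hC x hx))
    · noncomm_ring
  add_mem' := by
    rintro _ _ ⟨A, -, B, -, hA, hB, rfl⟩ ⟨C, -, D, -, hC, hD, rfl⟩
    refine ⟨A + C, trivial, B + D, trivial, ?_, ?_, ?_⟩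
    · exact fun x hx => add_nonneg (hA x hx) (hC x hx)
    · exact fun x hx => add_nonneg (hB x hx) (hD x hx)
    · abel
  algebraMap_mem' := by
    intro r
    refine ⟨max r 0 • 1, trivial, max (-r) 0 • 1, trivial, ?_, ?_, ?_⟩
    · exact fun x hx => smul_nonneg (le_max_right _ _) hx
    · exact fun x hx => smul_nonneg (le_max_right _ _) hx
    · rw [← sub_smul, Algebra.algebraMap_eq_smul_one]
      congr 1
      rcases le_total r 0 with h | h
      · rw [max_eq_right h, max_eq_left (by linarith)]; ring
      · rw [max_eq_left h, max_eq_right (by linarith)]; ring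

/-- The algebra `L_r(E)` of regular operators on `E`. It is a type of its own because it carries
the regular norm and not the operator norm. -/
def RegOp : Type _ := regularSubalgebra E

namespace RegOp

noncomputable instance instRing : Ring (RegOp E) :=
  inferInstanceAs (Ring (regularSubalgebra E))

noncomputable instance instAlgebra : Algebra ℝ (RegOp E) :=
  inferInstanceAs (Algebra ℝ (regularSubalgebra E))

variable {E}

/-- The bounded operator underlying a regular operator. -/
def toOp (T : RegOp E) : E →L[ℝ] E := Subtype.val T

theorem toOp_injective : Function.Injective (toOp (E := E)) := Subtype.val_injective

@[simp] theorem toOp_zero : toOp (0 : RegOp E) = 0 := rfl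
@[simp] theorem toOp_one : toOp (1 : RegOp E) = ContinuousLinearMap.id ℝ E := rfl
@[simp] theorem toOp_add (S T : RegOp E) : toOp (S + T) = toOp S + toOp T := rfl
@[simp] theorem toOp_neg (T : RegOp E) : toOp (-T) = -toOp T := rfl
@[simp] theorem toOp_sub (S T : RegOp E) : toOp (S - T) = toOp S - toOp T := rfl
@[simp] theorem toOp_mul (S T : RegOp E) : toOp (S * T) = (toOp S).comp (toOp T) := rfl
@[simp] theorem toOp_smul (c : ℝ) (T : RegOp E) : toOp (c • T) = c • toOp T := rfl

/-- The order of operators: `S ≤ T` iff `S x ≤ T x` for all `x ≥ 0`. -/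
instance instPartialOrder : PartialOrder (RegOp E) where
  le S T := ∀ x : E, 0 ≤ x → toOp S x ≤ toOp T x
  le_refl _ _ _ := le_rfl
  le_trans _ _ _ h h' x hx := (h x hx).trans (h' x hx)
  le_antisymm S T h h' := by
    refine toOp_injective (ContinuousLinearMap.ext fun x => ?_)
    rw [← posPart_sub_negPart x, map_sub, map_sub,
      (h _ (posPart_nonneg x)).antisymm (h' _ (posPart_nonneg x)),
      (h _ (negPart_nonneg x)).antisymm (h' _ (negPart_nonneg x))]

theorem le_def (S T : RegOp E) : S ≤ T ↔ ∀ x : E, 0 ≤ x → toOp S x ≤ toOp T x := Iff.rfl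

instance instIsOrderedAddMonoid : IsOrderedAddMonoid (RegOp E) where
  add_le_add_left S T h U x hx := by simpa using h x hx

instance instIsOrderedModule : IsOrderedModule ℝ (RegOp E) where
  smul_le_smul_of_nonneg_left _ hc _ _ h x hx := smul_le_smul_of_nonneg_left (h x hx) hc
  smul_le_smul_of_nonneg_right _ hT _ _ h x hx :=
    smul_le_smul_of_nonneg_right h (hT x hx)

/-- The bounded operators `S` with `± T ≤ S`. -/
def dominants (T : RegOp E) : Set (E →L[ℝ] E) :=
  {S | ∀ x : E, 0 ≤ x → toOp T x ≤ S x ∧ -(toOp T x) ≤ S x}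

/-- The regular norm `inf {‖S‖ : ± T ≤ S}`. -/
noncomputable instance instNorm : Norm (RegOp E) where
  norm T := sInf ((fun S : E →L[ℝ] E => ‖S‖) '' dominants T)

theorem norm_def (T : RegOp E) : ‖T‖ = sInf ((fun S : E →L[ℝ] E => ‖S‖) '' dominants T) := rfl

theorem dominants_nonempty (T : RegOp E) : (dominants T).Nonempty := by
  obtain ⟨_, A, -, B, -, hA, hB, rfl⟩ := T
  refine ⟨A + B, fun x hx => ?_⟩
  have h1 := hA x hx
  have h2 := hB x hx
  change A x - B x ≤ A x + B x ∧ -(A x - B x) ≤ A x + B x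
  constructor
  · exact (sub_le_self _ h2).trans (le_add_of_nonneg_right h2)
  · rw [neg_sub]
    exact (sub_le_self _ h1).trans (le_add_of_nonneg_left h1)

theorem norm_le_of_mem {T : RegOp E} {S : E →L[ℝ] E} (h : S ∈ dominants T) : ‖T‖ ≤ ‖S‖ :=
  csInf_le ⟨0, by rintro _ ⟨S, -, rfl⟩; exact norm_nonneg S⟩ ⟨S, h, rfl⟩

theorem le_norm_of_forall {T : RegOp E} {c : ℝ} (h : ∀ S ∈ dominants T, c ≤ ‖S‖) : c ≤ ‖T‖ :=
  le_csInf ((dominants_nonempty T).image _) (by rintro _ ⟨S, hS, rfl⟩; exact h S hS)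

theorem norm_toOp_le_of_mem [HasSolidNorm E] {T : RegOp E} {S : E →L[ℝ] E}
    (h : S ∈ dominants T) : ‖toOp T‖ ≤ ‖S‖ := by
  refine ContinuousLinearMap.opNorm_le_bound _ (norm_nonneg S) fun x => ?_
  have key : |toOp T x| ≤ S |x| := by
    have hp := h _ (posPart_nonneg x)
    have hn := h _ (negPart_nonneg x)
    have e1 : toOp T x = toOp T x⁺ - toOp T x⁻ := by
      rw [← map_sub, posPart_sub_negPart]
    have e2 : S |x| = S x⁺ + S x⁻ := by rw [← map_add, posPart_add_negPart]
    rw [abs_le', e1, e2]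
    constructor
    · rw [sub_eq_add_neg]; exact add_le_add hp.1 hn.2
    · rw [neg_sub, sub_eq_add_neg, add_comm]; exact add_le_add hp.2 hn.1
  calc ‖toOp T x‖ ≤ ‖S |x|‖ := norm_le_norm_of_abs_le_abs (key.trans (le_abs_self _))
    _ ≤ ‖S‖ * ‖|x|‖ := S.le_opNorm _
    _ = ‖S‖ * ‖x‖ := by rw [norm_abs_eq_norm]

theorem norm_toOp_le [HasSolidNorm E] (T : RegOp E) : ‖toOp T‖ ≤ ‖T‖ :=
  le_norm_of_forall fun _ hS => norm_toOp_le_of_mem hS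

theorem norm_smul_le' (c : ℝ) (T : RegOp E) : ‖c • T‖ ≤ ‖c‖ * ‖T‖ := by
  rcases eq_or_ne c 0 with rfl | hc
  · have h0 : (0 : E →L[ℝ] E) ∈ dominants ((0 : ℝ) • T) := fun x _ => by simp
    simpa using norm_le_of_mem h0
  · rw [← div_le_iff₀' (norm_pos_iff.mpr hc)]
    refine le_norm_of_forall fun S hS => ?_
    rw [div_le_iff₀' (norm_pos_iff.mpr hc)]
    have hm : |c| • S ∈ dominants (c • T) := by
      intro x hx
      obtain ⟨h1, h2⟩ := hS x hx
      change c • toOp T x ≤ |c| • S x ∧ -(c • toOp T x) ≤ |c| • S x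
      rcases le_total c 0 with h | h
      · rw [abs_of_nonpos h]
        have h1' := smul_le_smul_of_nonneg_left h1 (neg_nonneg.mpr h)
        have h2' := smul_le_smul_of_nonneg_left h2 (neg_nonneg.mpr h)
        rw [neg_smul, neg_smul] at h1'
        rw [smul_neg, neg_smul, neg_neg] at h2'
        exact ⟨h2', by rwa [neg_smul]⟩
      · rw [abs_of_nonneg h]
        have h2' := smul_le_smul_of_nonneg_left h2 h
        rw [smul_neg] at h2'
        exact ⟨smul_le_smul_of_nonneg_left h1 h, h2'⟩
    refine (norm_le_of_mem hm).trans_eq ?_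
    rw [norm_smul, Real.norm_eq_abs, Real.norm_eq_abs, abs_abs]

theorem normCore [HasSolidNorm E] : NormedSpace.Core ℝ (RegOp E) where
  norm_nonneg T := le_norm_of_forall fun S _ => norm_nonneg S
  norm_smul c T := by
    refine (norm_smul_le' c T).antisymm ?_
    rcases eq_or_ne c 0 with rfl | hc
    · rw [norm_zero, zero_mul]
      exact le_norm_of_forall fun S _ => norm_nonneg S
    · have h := norm_smul_le' c⁻¹ (c • T)
      rw [inv_smul_smul₀ hc, norm_inv] at h
      rwa [← le_inv_mul_iff₀ (norm_pos_iff.mpr hc)]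
  norm_triangle S T := by
    rw [← sub_le_iff_le_add]
    refine le_norm_of_forall fun A hA => ?_
    rw [sub_le_comm]
    refine le_norm_of_forall fun B hB => ?_
    rw [sub_le_iff_le_add']
    have hm : A + B ∈ dominants (S + T) := by
      intro x hx
      obtain ⟨h1, h2⟩ := hA x hx
      obtain ⟨h3, h4⟩ := hB x hx
      change toOp S x + toOp T x ≤ A x + B x ∧ -(toOp S x + toOp T x) ≤ A x + B x
      refine ⟨add_le_add h1 h3, ?_⟩
      rw [neg_add]
      exact add_le_add h2 h4
    exact (norm_le_of_mem hm).trans (norm_add_le A B)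
  norm_eq_zero_iff T := by
    constructor
    · intro h
      refine toOp_injective (norm_le_zero_iff.mp ?_)
      exact (norm_toOp_le T).trans h.le
    · rintro rfl
      have h0 : (0 : E →L[ℝ] E) ∈ dominants (0 : RegOp E) := fun x _ => by simp
      refine le_antisymm ((norm_le_of_mem h0).trans_eq norm_zero) ?_
      exact le_norm_of_forall fun S _ => norm_nonneg S

noncomputable instance instNormedAddCommGroup [HasSolidNorm E] : NormedAddCommGroup (RegOp E) :=
  NormedAddCommGroup.ofCore normCore

noncomputable instance instNormedSpace [HasSolidNorm E] : NormedSpace ℝ (RegOp E) :=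
  NormedSpace.ofCore normCore

end RegOp

/-- `r-l-Lwc(E)`, as a subset of `L_r(E)`. -/
def rLLwc : Set (RegOp E) :=
  {T | IsRegularIn {S : E →L[ℝ] E | IsLLwc S} T.toOp}

/-- `r-l-Mwc(E)`, as a subset of `L_r(E)`. -/
def rLMwc : Set (RegOp E) :=
  {T | IsRegularIn {S : E →L[ℝ] E | IsLMwc S} T.toOp}

end Regular

/-- `L` is the lattice structure of the operator order on `L_r(E)`, and it makes `L_r(E)` with the
regular norm a Banach lattice. -/
def IsRegOpBanachLattice {E : Type*} [NormedAddCommGroup E] [NormedSpace ℝ E] [Lattice E]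
    [IsOrderedAddMonoid E] [IsOrderedModule ℝ E] [HasSolidNorm E] (L : Lattice (RegOp E)) : Prop :=
  L.toSemilatticeSup.toPartialOrder = RegOp.instPartialOrder ∧
    @HasSolidNorm (RegOp E) RegOp.instNormedAddCommGroup L ∧ CompleteSpace (RegOp E)

/-- Closed order ideals of a normed vector lattice: norm-closed solid vector subspaces. -/
def IsClosedOrderIdeal {V : Type*} [NormedAddCommGroup V] [NormedSpace ℝ V] [Lattice V]
    (I : Set V) : Prop :=
  (∃ p : Submodule ℝ V, (p : Set V) = I) ∧ LatticeOrderedAddCommGroup.IsSolid I ∧ IsClosed I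

/-! Limited sets enter only through `isLLwc_iff`: an operator is l-Lwc iff it takes values in the
order continuous part `{u | IsLwcSet {u}}`. For the nontrivial direction, let `A` be limited and let
a disjoint sequence satisfy `|y n| ≤ |T (a n)|` with `a n ∈ A`. Hahn–Banach for the seminorm
`bandNorm (y n)` gives functionals `f n` bounded by it, with `f n (T (a n)) ≥ ‖y n‖`. Disjointness
forces `bandNorm (y n) (T x) → 0` for every fixed `x`, so the `f n ∘ T` are weak-star null, hence
uniformly small on `A`, and `y n → 0`.

Both classes are therefore stable under sums, non-negative multiples, domination between positive
operators and operator-norm limits. l-Lwc operators absorb bounded operators on the right, l-Mwc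
operators on the left. Part (i) follows, since `1` is regular and each regular operator factors
through the identity.

For (ii), the Riesz–Kantorovich formula supplies moduli. The operators dominating `± T` are the
positive ones above `|T|`, so the regular norm is a lattice norm. With the stability properties, `T`
is r-`P` iff `|T| ∈ P`, which gives solidity at once and closedness through continuity of the
modulus. -/

set_option linter.unusedSectionVars false

/-! ### Vector lattices -/

section VectorLattice

variable {F : Type*} [AddCommGroup F] [Lattice F] [IsOrderedAddMonoid F]

theorem add_inf_le_inf_add_inf {a b c : F} (ha : 0 ≤ a) (hb : 0 ≤ b) (hc : 0 ≤ c) :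
    (a + b) ⊓ c ≤ a ⊓ c + b ⊓ c := by
  have h1 : (a + b) ⊓ c - b ⊓ c ≤ a ⊓ c := by
    refine le_inf ?_ ?_
    · rw [sub_le_iff_le_add, add_inf]
      exact le_inf inf_le_left (inf_le_right.trans (le_add_of_nonneg_left ha))
    · exact (sub_le_self _ (le_inf hb hc)).trans inf_le_right
  exact sub_le_iff_le_add.mp h1

/-- The Riesz decomposition: `a` is the sum of `a ⊓ b`, below `b`, and `a - a ⊓ b`, below `c`. -/
theorem sub_inf_le_of_le_add {a b c : F} (hc : 0 ≤ c) (h : a ≤ b + c) : a - a ⊓ b ≤ c := by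
  rw [sub_le_comm]
  exact le_inf (sub_le_self _ hc) (sub_le_iff_le_add.mpr h)

theorem IsDisjointSeq.of_abs_le {x y : ℕ → F} (hx : IsDisjointSeq x)
    (h : ∀ n, |y n| ≤ |x n|) : IsDisjointSeq y := fun m n hmn =>
  le_antisymm ((inf_le_inf (h m) (h n)).trans_eq (hx m n hmn))
    (le_inf (abs_nonneg _) (abs_nonneg _))

theorem IsDisjointSeq.abs {x : ℕ → F} (hx : IsDisjointSeq x) :
    IsDisjointSeq fun n => |x n| := hx.of_abs_le fun n => by simp

variable [Module ℝ F] [IsOrderedModule ℝ F]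

theorem smul_inf_of_pos {c : ℝ} (hc : 0 < c) (a b : F) : c • (a ⊓ b) = c • a ⊓ c • b :=
  OrderIso.map_inf (OrderIso.smulRight (β := F) hc) a b

theorem abs_smul_of_pos {c : ℝ} (hc : 0 < c) (a : F) : |c • a| = c • |a| := by
  have := OrderIso.map_sup (OrderIso.smulRight (β := F) hc) a (-a)
  simp only [OrderIso.smulRight_apply, smul_neg] at this
  exact this.symm

theorem IsDisjointSeq.of_abs_le_smul {x y : ℕ → F} (hx : IsDisjointSeq x) (t : ℕ → ℝ)
    (ht : ∀ n, 0 ≤ t n) (h : ∀ n, |y n| ≤ t n • |x n|) : IsDisjointSeq y := fun m n hmn => by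
  refine le_antisymm ?_ (le_inf (abs_nonneg _) (abs_nonneg _))
  -- The extra 1 keeps the common scalar positive when both multipliers vanish, as `smul_inf_of_pos`
  -- requires.
  have hs : 0 < t m + t n + 1 := by linarith [ht m, ht n]
  calc |y m| ⊓ |y n| ≤ (t m + t n + 1) • |x m| ⊓ (t m + t n + 1) • |x n| := by
        refine inf_le_inf ((h m).trans ?_) ((h n).trans ?_) <;>
          exact smul_le_smul_of_nonneg_right (by linarith [ht m, ht n]) (abs_nonneg _)
    _ = 0 := by rw [← smul_inf_of_pos hs, hx m n hmn, smul_zero]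

end VectorLattice

/-! ### L-weakly compact sets -/

section Lwc

variable {F : Type*} [NormedAddCommGroup F] [Lattice F] [IsOrderedAddMonoid F] [HasSolidNorm F]

/-- Riesz decomposition splits each `|x n|` into a part below `|a n|` and a part below `|b n|`. Both
parts lie below `|x n|`, so each forms a disjoint sequence. Taking `B = {0}` gives stability under
domination. -/
theorem IsLwcSet.of_abs_le_add {A B C : Set F} (hA : IsLwcSet A) (hB : IsLwcSet B)
    (h : ∀ c ∈ C, ∃ a ∈ A, ∃ b ∈ B, |c| ≤ |a| + |b|) : IsLwcSet C := by
  intro x hx hd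
  have h' : ∀ n, ∃ a ∈ A, ∃ b ∈ B, |x n| ≤ |a| + |b| := fun n => by
    obtain ⟨c, hc, hxc⟩ := hx n
    obtain ⟨a, ha, b, hb, hab⟩ := h c hc
    exact ⟨a, ha, b, hb, hxc.trans hab⟩
  choose a ha b hb hab using h'
  have hn1 : ∀ n, 0 ≤ |x n| ⊓ |a n| := fun n => le_inf (abs_nonneg _) (abs_nonneg _)
  have hn2 : ∀ n, 0 ≤ |x n| - |x n| ⊓ |a n| := fun n => sub_nonneg.mpr inf_le_left
  have h1 : Tendsto (fun n => |x n| ⊓ |a n|) atTop (𝓝 0) := by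
    refine hA _ (fun n => ⟨a n, ha n, ?_⟩) (hd.of_abs_le fun n => ?_)
    · rw [abs_of_nonneg (hn1 n)]; exact inf_le_right
    · rw [abs_of_nonneg (hn1 n)]; exact inf_le_left
  have h2 : Tendsto (fun n => |x n| - |x n| ⊓ |a n|) atTop (𝓝 0) := by
    refine hB _ (fun n => ⟨b n, hb n, ?_⟩) (hd.of_abs_le fun n => ?_)
    · rw [abs_of_nonneg (hn2 n)]; exact sub_inf_le_of_le_add (abs_nonneg _) (hab n)
    · rw [abs_of_nonneg (hn2 n)]; exact sub_le_self _ (hn1 n)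
  have h3 := h1.add h2
  simp only [add_sub_cancel, add_zero] at h3
  rw [tendsto_zero_iff_norm_tendsto_zero] at h3 ⊢
  simpa only [norm_abs_eq_norm] using h3

theorem isLwcSet_singleton_zero : IsLwcSet ({0} : Set F) := by
  rintro x hx -
  have : x = fun _ => 0 := by
    funext n
    obtain ⟨_, rfl, h⟩ := hx n
    rw [abs_zero] at h
    have h0 := le_antisymm h (abs_nonneg _)
    exact norm_eq_zero.mp (by rw [← norm_abs_eq_norm, h0, norm_zero])
  rw [this]
  exact tendsto_const_nhds

theorem IsLwcSet.singleton_of_abs_le {u v : F} (hu : IsLwcSet {u}) (h : |v| ≤ |u|) :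
    IsLwcSet {v} := by
  refine hu.of_abs_le_add isLwcSet_singleton_zero ?_
  rintro _ rfl
  exact ⟨u, rfl, 0, rfl, by simpa using h⟩

theorem IsLwcSet.singleton_add {u v : F} (hu : IsLwcSet {u}) (hv : IsLwcSet {v}) :
    IsLwcSet {u + v} := by
  refine hu.of_abs_le_add hv ?_
  rintro _ rfl
  exact ⟨u, rfl, v, rfl, abs_add_le u v⟩

theorem IsLwcSet.singleton_neg {u : F} (hu : IsLwcSet {u}) : IsLwcSet {-u} :=
  hu.singleton_of_abs_le (abs_neg u).le

theorem IsLwcSet.singleton_smul [NormedSpace ℝ F] [IsOrderedModule ℝ F] {u : F}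
    (hu : IsLwcSet {u}) {c : ℝ} (hc : 0 ≤ c) : IsLwcSet {c • u} := by
  rcases hc.eq_or_lt with rfl | hc
  · rw [zero_smul]; exact isLwcSet_singleton_zero
  intro x hx hd
  have hc' := inv_pos.mpr hc
  have h1 : Tendsto (fun n => c⁻¹ • x n) atTop (𝓝 0) := by
    refine hu _ (fun n => ⟨u, rfl, ?_⟩) ?_
    · obtain ⟨_, rfl, h⟩ := hx n
      have h2 := smul_le_smul_of_nonneg_left h hc'.le
      rwa [abs_smul_of_pos hc, inv_smul_smul₀ hc.ne', ← abs_smul_of_pos hc'] at h2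
    · exact hd.of_abs_le_smul (fun _ => c⁻¹) (fun _ => hc'.le)
        fun n => (abs_smul_of_pos hc' _).le
  simpa [smul_smul, hc.ne'] using h1.const_smul c

/-- The order continuous part of a normed lattice is norm-closed. -/
theorem isClosed_setOf_isLwcSet_singleton : IsClosed {u : F | IsLwcSet {u}} := by
  refine isClosed_of_closure_subset fun u hu x hx hd => ?_
  rw [Metric.tendsto_atTop]
  intro ε hε
  obtain ⟨v, hv, huv⟩ := Metric.mem_closure_iff.mp hu (ε / 2) (half_pos hε)
  have hn1 : ∀ n, 0 ≤ |x n| ⊓ |v| := fun n => le_inf (abs_nonneg _) (abs_nonneg _)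
  have hn2 : ∀ n, 0 ≤ |x n| - |x n| ⊓ |v| := fun n => sub_nonneg.mpr inf_le_left
  have h1 : Tendsto (fun n => |x n| ⊓ |v|) atTop (𝓝 0) := by
    refine hv _ (fun n => ⟨v, rfl, ?_⟩) (hd.of_abs_le fun n => ?_)
    · rw [abs_of_nonneg (hn1 n)]; exact inf_le_right
    · rw [abs_of_nonneg (hn1 n)]; exact inf_le_left
  obtain ⟨N, hN⟩ := Metric.tendsto_atTop.mp h1 (ε / 2) (half_pos hε)
  refine ⟨N, fun n hn => ?_⟩
  -- The part of `|x n|` not captured by `|v|` is below `|u - v|`, uniformly in `n`.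
  have h2 : ‖|x n| - |x n| ⊓ |v|‖ ≤ ‖u - v‖ := by
    refine norm_le_norm_of_abs_le_abs ?_
    rw [abs_of_nonneg (hn2 n)]
    refine sub_inf_le_of_le_add (abs_nonneg _) ?_
    obtain ⟨_, rfl, h⟩ := hx n
    exact h.trans (by simpa using abs_add_le v (_ - v))
  have h3 := hN n hn
  rw [dist_zero_right] at h3 ⊢
  rw [dist_eq_norm] at huv
  calc ‖x n‖ = ‖(|x n| - |x n| ⊓ |v|) + |x n| ⊓ |v|‖ := by rw [sub_add_cancel, norm_abs_eq_norm]
    _ ≤ _ := norm_add_le _ _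
    _ < ε := by linarith

end Lwc

/-! ### The seminorm of the band generated by an element -/

section Band

open scoped NNReal

variable {F : Type*} [NormedAddCommGroup F] [NormedSpace ℝ F] [Lattice F] [IsOrderedAddMonoid F]
  [IsOrderedModule ℝ F] [HasSolidNorm F]

/-- The norm of the part of `z` in the band generated by `y`. -/
noncomputable def bandNorm (y z : F) : ℝ := ⨆ t : ℝ≥0, ‖|z| ⊓ (t : ℝ) • |y|‖

theorem norm_abs_inf_le (y z : F) (t : ℝ≥0) : ‖|z| ⊓ (t : ℝ) • |y|‖ ≤ ‖z‖ := by
  refine norm_le_norm_of_abs_le_abs ?_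
  rw [abs_of_nonneg (le_inf (abs_nonneg _) (smul_nonneg t.coe_nonneg (abs_nonneg y)))]
  exact inf_le_left

theorem norm_abs_inf_le_bandNorm (y z : F) (t : ℝ≥0) : ‖|z| ⊓ (t : ℝ) • |y|‖ ≤ bandNorm y z :=
  le_ciSup (f := fun t : ℝ≥0 => ‖|z| ⊓ (t : ℝ) • |y|‖)
    ⟨‖z‖, by rintro _ ⟨t, rfl⟩; exact norm_abs_inf_le y z t⟩ t

theorem bandNorm_le (y z : F) : bandNorm y z ≤ ‖z‖ := ciSup_le (norm_abs_inf_le y z)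

theorem bandNorm_nonneg (y z : F) : 0 ≤ bandNorm y z := Real.iSup_nonneg fun _ => norm_nonneg _

theorem bandNorm_neg (y z : F) : bandNorm y (-z) = bandNorm y z := by
  simp only [bandNorm, abs_neg]

theorem norm_le_bandNorm {y z : F} (h : |y| ≤ |z|) : ‖y‖ ≤ bandNorm y z := by
  have := norm_abs_inf_le_bandNorm y z 1
  rwa [NNReal.coe_one, one_smul, inf_eq_right.mpr h, norm_abs_eq_norm] at this

theorem bandNorm_add_le (y z w : F) : bandNorm y (z + w) ≤ bandNorm y z + bandNorm y w := by
  refine ciSup_le fun t => ?_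
  have ht : 0 ≤ (t : ℝ) • |y| := smul_nonneg t.coe_nonneg (abs_nonneg y)
  calc ‖|z + w| ⊓ (t : ℝ) • |y|‖ ≤ ‖|z| ⊓ (t : ℝ) • |y| + |w| ⊓ (t : ℝ) • |y|‖ := by
        refine norm_le_norm_of_abs_le_abs ?_
        rw [abs_of_nonneg (le_inf (abs_nonneg _) ht)]
        refine le_trans ?_ (le_abs_self _)
        exact (inf_le_inf_right _ (abs_add_le z w)).trans
          (add_inf_le_inf_add_inf (abs_nonneg _) (abs_nonneg _) ht)
    _ ≤ _ := norm_add_le _ _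
    _ ≤ _ := add_le_add (norm_abs_inf_le_bandNorm y z t) (norm_abs_inf_le_bandNorm y w t)

theorem bandNorm_smul_le (y z : F) {c : ℝ} (hc : 0 < c) :
    bandNorm y (c • z) ≤ c * bandNorm y z := by
  refine ciSup_le fun t => ?_
  -- Scaling `z` by `c` only reparametrizes the supremum, by `t ↦ c⁻¹ * t`.
  have h : |c • z| ⊓ (t : ℝ) • |y| = c • (|z| ⊓ ((c⁻¹.toNNReal * t : ℝ≥0) : ℝ) • |y|) := by
    rw [smul_inf_of_pos hc, abs_smul_of_pos hc, smul_smul, NNReal.coe_mul,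
      Real.coe_toNNReal _ (inv_pos.mpr hc).le,      mul_inv_cancel_left₀ hc.ne']
  rw [h, norm_smul, Real.norm_of_nonneg hc.le]
  exact mul_le_mul_of_nonneg_left (norm_abs_inf_le_bandNorm y z _) hc.le

theorem bandNorm_smul (y z : F) {c : ℝ} (hc : 0 < c) :
    bandNorm y (c • z) = c * bandNorm y z := by
  refine (bandNorm_smul_le y z hc).antisymm ?_
  have h := bandNorm_smul_le y (c • z) (inv_pos.mpr hc)
  rwa [inv_smul_smul₀ hc.ne', le_inv_mul_iff₀ hc] at h

/-- Hahn–Banach: the functional with value `bandNorm y z` at `z` is extended from the line through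
`z` under the sublinear `bandNorm y`. Continuity is free because `bandNorm y` is at most the norm.
-/
theorem exists_dual_le_bandNorm (y z : F) :
    ∃ f : StrongDual ℝ F, (∀ w, |f w| ≤ bandNorm y w) ∧ bandNorm y z ≤ f z := by
  rcases eq_or_ne z 0 with rfl | hz
  · refine ⟨0, fun w => by simpa using bandNorm_nonneg y w, ?_⟩
    simpa using bandNorm_le y (0 : F)
  obtain ⟨g, hg1, hg2⟩ := exists_extension_of_le_sublinear
    (LinearPMap.mkSpanSingleton z (bandNorm y z) hz) (bandNorm y)
    (fun c hc x => bandNorm_smul y x hc) (bandNorm_add_le y) (by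
      rintro ⟨w, hw⟩
      obtain ⟨c, rfl⟩ := Submodule.mem_span_singleton.mp hw
      rw [LinearPMap.mkSpanSingleton'_apply, RingHom.id_apply, smul_eq_mul]
      rcases le_or_gt c 0 with h | h
      · exact (mul_nonpos_of_nonpos_of_nonneg h (bandNorm_nonneg _ _)).trans
          (bandNorm_nonneg _ _)
      · exact (bandNorm_smul y z h).ge)
  have habs : ∀ w, |g w| ≤ bandNorm y w := fun w =>
    abs_le'.mpr ⟨hg2 w, by rw [← map_neg, ← bandNorm_neg]; exact hg2 _⟩
  refine ⟨g.mkContinuous 1 fun w => ?_, habs, ?_⟩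
  · rw [one_mul]; exact (habs w).trans (bandNorm_le y w)
  · have hmem : z ∈ Submodule.span ℝ {z} :=
      Submodule.mem_span_singleton_self z
    have h := hg1 ⟨z, hmem⟩
    rw [LinearPMap.mkSpanSingleton_apply] at h
    exact h.ge

/-- For any scalars `t n ≥ 0` the elements `|u| ⊓ t n • |y n|` inherit disjointness from `y` and lie
below `|u|`, hence are norm-null. Choosing `t n` nearly optimal controls the suprema. -/
theorem tendsto_bandNorm_zero {y : ℕ → F} (hy : IsDisjointSeq y) {u : F} (hu : IsLwcSet {u}) :
    Tendsto (fun n => bandNorm (y n) u) atTop (𝓝 0) := by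
  have hex : ∀ n : ℕ, ∃ t : ℝ≥0, bandNorm (y n) u - 1 / ((n : ℝ) + 1) < ‖|u| ⊓ (t : ℝ) • |y n|‖ :=
    fun n => exists_lt_of_lt_ciSup (sub_lt_self _ Nat.one_div_pos_of_nat)
  choose t ht using hex
  have hn : ∀ n, 0 ≤ |u| ⊓ (t n : ℝ) • |y n| := fun n =>
    le_inf (abs_nonneg _) (smul_nonneg (t n).coe_nonneg (abs_nonneg _))
  have h1 : Tendsto (fun n => |u| ⊓ (t n : ℝ) • |y n|) atTop (𝓝 0) := by
    refine hu _ (fun n => ⟨u, rfl, ?_⟩)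
      (hy.of_abs_le_smul (fun n => t n) (fun n => (t n).coe_nonneg) fun n => ?_)
    · rw [abs_of_nonneg (hn n)]; exact inf_le_left
    · rw [abs_of_nonneg (hn n)]; exact inf_le_right
  have h2 := h1.norm.add (tendsto_one_div_add_atTop_nhds_zero_nat (𝕜 := ℝ))
  rw [norm_zero, add_zero] at h2
  exact squeeze_zero (fun n => bandNorm_nonneg _ _) (fun n => by linarith [ht n]) h2

end Band

theorem LinearMap.abs_apply_le_of_nonneg {E F : Type*} [AddCommGroup E] [Module ℝ E]
    [Lattice E] [IsOrderedAddMonoid E] [AddCommGroup F] [Module ℝ F] [Lattice F]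
    [IsOrderedAddMonoid F] {P : E →ₗ[ℝ] F}
    (hP : ∀ x, 0 ≤ x → 0 ≤ P x) (x : E) : |P x| ≤ P |x| := by
  rw [abs_le', ← map_neg, ← sub_nonneg, ← map_sub, ← sub_nonneg (a := P |x|), ← map_sub]
  exact ⟨hP _ (sub_nonneg.mpr (le_abs_self x)), hP _ (sub_nonneg.mpr (neg_le_abs x))⟩

/-! ### l-Lwc and l-Mwc operators -/

section Operators

variable {X F : Type*} [NormedAddCommGroup X] [NormedSpace ℝ X] [NormedAddCommGroup F]
  [NormedSpace ℝ F] [Lattice F] [IsOrderedAddMonoid F] [IsOrderedModule ℝ F] [HasSolidNorm F]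

theorem tendsto_weakDual_zero_iff {f : ℕ → WeakDual ℝ X} :
    Tendsto f atTop (𝓝 0) ↔ ∀ x, Tendsto (fun n => f n x) atTop (𝓝 0) :=
  tendsto_iff_forall_eval_tendsto_topDualPairing

theorem isLimitedSet_singleton (x : X) : IsLimitedSet {x} := by
  refine ⟨Bornology.isBounded_singleton, fun f hf => ?_⟩
  rw [tendstoUniformlyOn_singleton_iff_tendsto]
  exact tendsto_weakDual_zero_iff.mp hf x

/-- An operator is l-Lwc iff it takes its values in the order continuous part. -/
theorem isLLwc_iff {T : X →L[ℝ] F} : IsLLwc T ↔ ∀ x, IsLwcSet {T x} := by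
  refine ⟨fun h x => by simpa using h _ (isLimitedSet_singleton x), fun h A hA y hy hd => ?_⟩
  have h' : ∀ n, ∃ a ∈ A, |y n| ≤ |T a| := fun n => by
    obtain ⟨_, ⟨a, ha, rfl⟩, hya⟩ := hy n
    exact ⟨a, ha, hya⟩
  choose a ha hya using h'
  -- `f n` nearly ignores fixed elements of the order continuous part for large `n`, yet is at least
  -- `‖y n‖` at `T (a n)`.
  choose f hf1 hf2 using fun n => exists_dual_le_bandNorm (y n) (T (a n))
  let g : ℕ → WeakDual ℝ X := fun n => (f n).comp T
  have hg : Tendsto g atTop (𝓝 0) := tendsto_weakDual_zero_iff.mpr fun x =>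
    squeeze_zero_norm (fun n => hf1 n (T x)) (tendsto_bandNorm_zero hd (h x))
  rw [Metric.tendsto_atTop]
  intro ε hε
  obtain ⟨N, hN⟩ := eventually_atTop.mp (Metric.tendstoUniformlyOn_iff.mp (hA.2 g hg) ε hε)
  refine ⟨N, fun n hn => ?_⟩
  rw [dist_zero_right]
  have h3 : ‖f n (T (a n))‖ < ε := by
    have := hN n hn (a n) (ha n)
    rwa [dist_zero_left] at this
  calc ‖y n‖ ≤ bandNorm (y n) (T (a n)) := norm_le_bandNorm (hya n)
    _ ≤ f n (T (a n)) := hf2 n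
    _ ≤ _ := le_abs_self _
    _ < ε := h3

theorem IsLLwc.add {S T : X →L[ℝ] F} (hS : IsLLwc S) (hT : IsLLwc T) : IsLLwc (S + T) :=
  isLLwc_iff.mpr fun x => (isLLwc_iff.mp hS x).singleton_add (isLLwc_iff.mp hT x)

theorem IsLLwc.neg {T : X →L[ℝ] F} (hT : IsLLwc T) : IsLLwc (-T) :=
  isLLwc_iff.mpr fun x => (isLLwc_iff.mp hT x).singleton_neg

theorem isLLwc_zero : IsLLwc (0 : X →L[ℝ] F) := isLLwc_iff.mpr fun _ => isLwcSet_singleton_zero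

theorem IsLLwc.smul {T : X →L[ℝ] F} (hT : IsLLwc T) {c : ℝ} (hc : 0 ≤ c) : IsLLwc (c • T) :=
  isLLwc_iff.mpr fun x => (isLLwc_iff.mp hT x).singleton_smul hc

theorem IsLLwc.comp {Z : Type*} [NormedAddCommGroup Z] [NormedSpace ℝ Z] {T : X →L[ℝ] F}
    (hT : IsLLwc T) (S : Z →L[ℝ] X) : IsLLwc (T.comp S) :=
  isLLwc_iff.mpr fun x => isLLwc_iff.mp hT (S x)

theorem IsPositiveOp.abs_apply_le {E : Type*} [NormedAddCommGroup E] [NormedSpace ℝ E] [Lattice E]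
    [IsOrderedAddMonoid E] {T : E →L[ℝ] F} (hT : IsPositiveOp T) (x : E) : |T x| ≤ T |x| :=
  LinearMap.abs_apply_le_of_nonneg (P := (T : E →ₗ[ℝ] F)) hT x

theorem IsLLwc.of_le {E : Type*} [NormedAddCommGroup E] [NormedSpace ℝ E] [Lattice E]
    [IsOrderedAddMonoid E] {S T : E →L[ℝ] F} (hT : IsLLwc T) (hS : IsPositiveOp S)
    (hST : ∀ x, 0 ≤ x → S x ≤ T x) : IsLLwc S :=
  isLLwc_iff.mpr fun x => (isLLwc_iff.mp hT |x|).singleton_of_abs_le <|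
    (hS.abs_apply_le x).trans ((hST _ (abs_nonneg x)).trans (le_abs_self _))

/-- By `isLLwc_iff` the set is an intersection of preimages, under the evaluations, of the closed
order continuous part. -/
theorem isClosed_setOf_isLLwc : IsClosed {T : X →L[ℝ] F | IsLLwc T} := by
  simp only [isLLwc_iff, Set.ofPred_forall]
  exact isClosed_iInter fun x => isClosed_setOf_isLwcSet_singleton.preimage
    (ContinuousLinearMap.apply ℝ F x).continuous

end Operators

/-! ### l-Mwc operators, tested on functionals -/

section LMwc

variable {E Y Z : Type*} [NormedAddCommGroup E] [NormedSpace ℝ E] [Lattice E]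
  [NormedAddCommGroup Y] [NormedSpace ℝ Y] [NormedAddCommGroup Z] [NormedSpace ℝ Z]

theorem isLMwc_iff {T : E →L[ℝ] Y} : IsLMwc T ↔ ∀ x : ℕ → E, IsDisjointSeq x →
    Bornology.IsBounded (Set.range x) → ∀ f : StrongDual ℝ Y,
      Tendsto (fun n => f (T (x n))) atTop (𝓝 0) := by
  refine forall₃_congr fun x _ _ => ⟨fun h f => ?_, fun h => ?_⟩
  · rw [← map_zero f]
    exact ((WeakBilin.eval_continuous (topDualPairing ℝ Y).flip f).tendsto 0).comp h
  · refine (WeakBilin.tendsto_iff_forall_eval_tendsto (topDualPairing ℝ Y).flip ?_).mpr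
      fun f => ?_
    -- The dual separates points, so the weak topology is induced by an injective pairing.
    · intro a b hab
      exact SeparatingDual.eq_iff_forall_dual_eq (R := ℝ) |>.mpr fun f => LinearMap.congr_fun hab f
    · have := h f
      rwa [← map_zero f] at this

theorem IsLMwc.add {S T : E →L[ℝ] Y} (hS : IsLMwc S) (hT : IsLMwc T) : IsLMwc (S + T) :=
  fun x hd hb => by simpa using (hS x hd hb).add (hT x hd hb)

theorem IsLMwc.neg {T : E →L[ℝ] Y} (hT : IsLMwc T) : IsLMwc (-T) :=
  fun x hd hb => by simpa using (hT x hd hb).neg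

theorem isLMwc_zero : IsLMwc (0 : E →L[ℝ] Y) :=
  fun x _ _ => by simp

theorem IsLMwc.smul {T : E →L[ℝ] Y} (hT : IsLMwc T) (c : ℝ) : IsLMwc (c • T) :=
  fun x hd hb => by simpa using (hT x hd hb).const_smul c

theorem IsLMwc.comp_left {T : E →L[ℝ] Y} (hT : IsLMwc T) (S : Y →L[ℝ] Z) : IsLMwc (S.comp T) :=
  isLMwc_iff.mpr fun x hd hb f => isLMwc_iff.mp hT x hd hb (f.comp S)

theorem isClosed_setOf_isLMwc : IsClosed {T : E →L[ℝ] Y | IsLMwc T} := by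
  refine isClosed_of_closure_subset fun T hT => isLMwc_iff.mpr fun x hd hb f => ?_
  obtain ⟨M, hM0, hM⟩ := hb.exists_pos_norm_le
  have hM' : ∀ n, ‖x n‖ ≤ M := fun n => hM _ ⟨n, rfl⟩
  rw [Metric.tendsto_atTop]
  intro ε hε
  -- `‖f‖ * M` is the factor by which `‖T - S‖` is amplified along the sequence; the 1 makes it a
  -- legitimate divisor when `f = 0`.
  have hK : 0 < ‖f‖ * M + 1 := by positivity
  obtain ⟨S, hS, hTS⟩ := Metric.mem_closure_iff.mp hT (ε / 2 / (‖f‖ * M + 1)) (by positivity)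
  obtain ⟨N, hN⟩ := Metric.tendsto_atTop.mp (isLMwc_iff.mp hS x hd hb f) (ε / 2) (half_pos hε)
  refine ⟨N, fun n hn => ?_⟩
  have h1 := hN n hn
  rw [dist_zero_right] at h1 ⊢
  rw [dist_eq_norm, lt_div_iff₀ hK] at hTS
  have h2 : ‖f ((T - S) (x n))‖ ≤ ‖f‖ * (‖T - S‖ * M) :=
    (f.le_opNorm _).trans (mul_le_mul_of_nonneg_left
      (((T - S).le_opNorm _).trans (mul_le_mul_of_nonneg_left (hM' n) (norm_nonneg _)))
      (norm_nonneg _))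
  have h3 : f (T (x n)) = f ((T - S) (x n)) + f (S (x n)) := by simp
  rw [h3]
  refine (norm_add_le _ _).trans_lt ?_
  nlinarith [norm_nonneg (T - S)]

end LMwc

/-! ### The Riesz–Kantorovich theorem -/

section RieszKantorovich

variable {E F : Type*} [AddCommGroup E] [Module ℝ E] [Lattice E] [IsOrderedAddMonoid E]
  [IsOrderedModule ℝ E] [AddCommGroup F] [Module ℝ F]

/-- An additive and positively homogeneous map on the positive cone extends to a linear map. -/
theorem exists_linearMap_of_add_on_nonneg (p : E → F)
    (hadd : ∀ x y, 0 ≤ x → 0 ≤ y → p (x + y) = p x + p y)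
    (hsmul : ∀ (c : ℝ) x, 0 < c → 0 ≤ x → p (c • x) = c • p x) :
    ∃ P : E →ₗ[ℝ] F, ∀ x, 0 ≤ x → P x = p x := by
  have h0 : p 0 = 0 := by simpa using hadd 0 0 le_rfl le_rfl
  -- The difference `p u - p v` depends only on `u - v`; this is what makes the extension `x ↦ p x⁺
  -- - p x⁻` linear.
  have key : ∀ u v : E, 0 ≤ u → 0 ≤ v → p (u - v)⁺ - p (u - v)⁻ = p u - p v := by
    intro u v hu hv
    have h1 := hadd (u - v)⁺ v (posPart_nonneg _) hv
    have h2 := hadd (u - v)⁻ u (negPart_nonneg _) hu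
    have h3 : (u - v)⁺ + v = (u - v)⁻ + u := by
      have h := posPart_sub_negPart (u - v)
      rw [sub_eq_iff_eq_add] at h
      nth_rw 1 [h]
      abel
    rw [sub_eq_sub_iff_add_eq_add, ← h1, h3, h2, add_comm]
  let P : E →ₗ[ℝ] F :=
    { toFun := fun x => p x⁺ - p x⁻
      map_add' := fun x y => by
        have h := key (x⁺ + y⁺) (x⁻ + y⁻) (add_nonneg (posPart_nonneg _) (posPart_nonneg _))
          (add_nonneg (negPart_nonneg _) (negPart_nonneg _))
        rw [add_sub_add_comm, posPart_sub_negPart, posPart_sub_negPart,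
          hadd _ _ (posPart_nonneg _) (posPart_nonneg _),
          hadd _ _ (negPart_nonneg _) (negPart_nonneg _)] at h
        rw [h, add_sub_add_comm]
      map_smul' := fun c x => by
        rw [RingHom.id_apply]
        rcases lt_trichotomy c 0 with hc | rfl | hc
        · have hc' := neg_pos.mpr hc
          have h := key (-c • x⁻) (-c • x⁺) (smul_nonneg hc'.le (negPart_nonneg _))
            (smul_nonneg hc'.le (posPart_nonneg _))
          rw [← smul_sub, ← neg_sub x⁺, posPart_sub_negPart, neg_smul_neg,
            hsmul _ _ hc' (posPart_nonneg _), hsmul _ _ hc' (negPart_nonneg _), ← smul_sub] at h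
          rw [h, neg_smul, ← smul_neg, neg_sub]
        · simp
        · have h := key (c • x⁺) (c • x⁻) (smul_nonneg hc.le (posPart_nonneg _))
            (smul_nonneg hc.le (negPart_nonneg _))
          rw [← smul_sub, posPart_sub_negPart,
            hsmul _ _ hc (posPart_nonneg _), hsmul _ _ hc (negPart_nonneg _), ← smul_sub] at h
          exact h }
  refine ⟨P, fun x hx => ?_⟩
  change p x⁺ - p x⁻ = p x
  rw [posPart_of_nonneg hx, negPart_of_nonneg hx, h0, sub_zero]

/-- The Riesz–Kantorovich formula for the positive part of an order bounded operator. -/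
theorem exists_linearMap_isLUB [Lattice F] [IsOrderedAddMonoid F] [IsOrderedModule ℝ F]
    (hF : IsDedekindComplete F) (T : E →ₗ[ℝ] F)
    (hT : ∀ x, 0 ≤ x → BddAbove (T '' Set.Icc 0 x)) :
    ∃ P : E →ₗ[ℝ] F, ∀ x, 0 ≤ x → IsLUB (T '' Set.Icc 0 x) (P x) := by
  have hex : ∀ x : E, ∃ a, 0 ≤ x → IsLUB (T '' Set.Icc 0 x) a := fun x => by
    by_cases hx : 0 ≤ x
    · obtain ⟨a, ha⟩ := hF _ (Set.Nonempty.image T (Set.nonempty_Icc.mpr hx)) (hT x hx)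
      exact ⟨a, fun _ => ha⟩
    -- Off the positive cone the value is irrelevant.
    · exact ⟨0, fun h => absurd h hx⟩
  choose p hp using hex
  have hle : ∀ {x y}, 0 ≤ y → y ≤ x → T y ≤ p x := fun {x y} hy hyx =>
    (hp x (hy.trans hyx)).1 ⟨y, ⟨hy, hyx⟩, rfl⟩
  have hlub : ∀ {x b}, 0 ≤ x → (∀ y, 0 ≤ y → y ≤ x → T y ≤ b) → p x ≤ b := fun {x b} hx h =>
    (hp x hx).2 (by rintro _ ⟨y, ⟨hy, hyx⟩, rfl⟩; exact h y hy hyx)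
  have hsmul_le : ∀ (c : ℝ) x, 0 < c → 0 ≤ x → p (c • x) ≤ c • p x := by
    intro c x hc hx
    refine hlub (smul_nonneg hc.le hx) fun y hy hyx => ?_
    have h1 : T (c⁻¹ • y) ≤ p x := by
      refine hle (smul_nonneg (inv_pos.mpr hc).le hy) ?_
      have := smul_le_smul_of_nonneg_left hyx (inv_pos.mpr hc).le
      rwa [inv_smul_smul₀ hc.ne'] at this
    have h2 := smul_le_smul_of_nonneg_left h1 hc.le
    rwa [map_smul, smul_inv_smul₀ hc.ne'] at h2
  suffices h : ∃ P : E →ₗ[ℝ] F, ∀ x, 0 ≤ x → P x = p x by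
    obtain ⟨P, hP⟩ := h
    exact ⟨P, fun x hx => by rw [hP x hx]; exact hp x hx⟩
  refine exists_linearMap_of_add_on_nonneg p (fun x y hx hy => ?_) fun c x hc hx => ?_
  -- Additivity amounts to `[0, x + y] = [0, x] + [0, y]`: the first inequality decomposes `z` as `z
  -- ⊓ x` plus a remainder below `y`, the second adds points of the two intervals.
  · refine le_antisymm (hlub (add_nonneg hx hy) fun z hz hzxy => ?_) ?_
    · have h1 : T (z ⊓ x) ≤ p x := hle (le_inf hz hx) inf_le_right
      have h2 : T (z - z ⊓ x) ≤ p y :=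
        hle (sub_nonneg.mpr inf_le_left) (sub_inf_le_of_le_add hy hzxy)
      have h3 := add_le_add h1 h2
      rwa [← map_add, add_sub_cancel] at h3
    · rw [← le_sub_iff_add_le]
      refine hlub hx fun u hu hux => ?_
      rw [le_sub_comm]
      refine hlub hy fun v hv hvy => ?_
      rw [le_sub_iff_add_le', ← map_add]
      exact hle (add_nonneg hu hv) (add_le_add hux hvy)
  · refine (hsmul_le c x hc hx).antisymm ?_
    have h := hsmul_le c⁻¹ (c • x) (inv_pos.mpr hc) (smul_nonneg hc.le hx)
    rw [inv_smul_smul₀ hc.ne'] at h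
    have h2 := smul_le_smul_of_nonneg_left h hc.le
    rwa [smul_inv_smul₀ hc.ne'] at h2

end RieszKantorovich

/-! ### Positive majorants of operators and functionals; domination of l-Mwc operators -/

section PositivePart

variable {E F : Type*} [NormedAddCommGroup E] [NormedSpace ℝ E] [Lattice E]
  [IsOrderedAddMonoid E] [IsOrderedModule ℝ E] [HasSolidNorm E] [NormedAddCommGroup F]
  [NormedSpace ℝ F] [Lattice F] [IsOrderedAddMonoid F] [IsOrderedModule ℝ F] [HasSolidNorm F]

/-- The positive majorant `A` does two things: `A x` bounds `T` on `[0, x]`, so the suprema exist,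
and `|P x| ≤ A |x|` makes `P` continuous. -/
theorem exists_continuousLinearMap_isLUB (hF : IsDedekindComplete F) {T A : E →L[ℝ] F}
    (hA : IsPositiveOp A) (hTA : ∀ x, 0 ≤ x → T x ≤ A x) :
    ∃ P : E →L[ℝ] F, ∀ x, 0 ≤ x → IsLUB (T '' Set.Icc 0 x) (P x) := by
  have hb : ∀ x : E, 0 ≤ x → A x ∈ upperBounds (T '' Set.Icc 0 x) := by
    rintro x - _ ⟨y, ⟨hy, hyx⟩, rfl⟩
    refine (hTA y hy).trans ?_
    rw [← sub_nonneg, ← map_sub]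
    exact hA _ (sub_nonneg.mpr hyx)
  obtain ⟨P, hP⟩ := exists_linearMap_isLUB hF (T : E →ₗ[ℝ] F) fun x hx => ⟨A x, hb x hx⟩
  have hP0 : ∀ x, 0 ≤ x → 0 ≤ P x := fun x hx => (hP x hx).1 ⟨0, ⟨le_rfl, hx⟩, by simp⟩
  refine ⟨P.mkContinuous ‖A‖ fun x => ?_, hP⟩
  calc ‖P x‖ ≤ ‖A |x|‖ := norm_le_norm_of_abs_le_abs <|
        (LinearMap.abs_apply_le_of_nonneg hP0 x).trans <|
          ((hP _ (abs_nonneg x)).2 (hb _ (abs_nonneg x))).trans (le_abs_self _)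
    _ ≤ ‖A‖ * ‖|x|‖ := A.le_opNorm _
    _ = ‖A‖ * ‖x‖ := by rw [norm_abs_eq_norm]

theorem isDedekindComplete_real : IsDedekindComplete ℝ := fun _ hs hb =>
  ⟨_, isLUB_csSup hs hb⟩

/-- No positive majorant is given here; monotonicity of the norm bounds `f` on `[0, x]` by `‖f‖ *
‖x‖` instead. -/
theorem exists_positive_dual_ge (f : StrongDual ℝ E) :
    ∃ g : StrongDual ℝ E, (∀ x, 0 ≤ x → 0 ≤ g x) ∧ ∀ x, 0 ≤ x → f x ≤ g x := by
  have hb : ∀ x : E, 0 ≤ x → ‖f‖ * ‖x‖ ∈ upperBounds (f '' Set.Icc 0 x) := by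
    rintro x hx _ ⟨y, ⟨hy, hyx⟩, rfl⟩
    refine (le_abs_self _).trans ((f.le_opNorm y).trans ?_)
    refine mul_le_mul_of_nonneg_left (norm_le_norm_of_abs_le_abs ?_) (norm_nonneg f)
    rwa [abs_of_nonneg hy, abs_of_nonneg hx]
  obtain ⟨P, hP⟩ := exists_linearMap_isLUB isDedekindComplete_real (f : E →ₗ[ℝ] ℝ)
    fun x hx => ⟨_, hb x hx⟩
  have hP0 : ∀ x, 0 ≤ x → 0 ≤ P x := fun x hx => (hP x hx).1 ⟨0, ⟨le_rfl, hx⟩, by simp⟩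
  refine ⟨P.mkContinuous ‖f‖ fun x => ?_, hP0, fun x hx => (hP x hx).1 ⟨x, ⟨hx, le_rfl⟩, rfl⟩⟩
  calc ‖P x‖ ≤ P |x| := LinearMap.abs_apply_le_of_nonneg hP0 x
    _ ≤ ‖f‖ * ‖|x|‖ := (hP _ (abs_nonneg x)).2 (hb _ (abs_nonneg x))
    _ = ‖f‖ * ‖x‖ := by rw [norm_abs_eq_norm]

theorem exists_dual_abs_le (f : StrongDual ℝ E) :
    ∃ g : StrongDual ℝ E, (∀ x, 0 ≤ x → 0 ≤ g x) ∧ ∀ x, |f x| ≤ g |x| := by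
  obtain ⟨g, hg, hfg⟩ := exists_positive_dual_ge f
  obtain ⟨h, hh, hfh⟩ := exists_positive_dual_ge (-f)
  refine ⟨g + h, fun x hx => add_nonneg (hg x hx) (hh x hx), fun x => ?_⟩
  have h1 := hfg _ (posPart_nonneg x)
  have h2 := hfg _ (negPart_nonneg x)
  have h3 := hfh _ (posPart_nonneg x)
  have h4 := hfh _ (negPart_nonneg x)
  have h5 := hg _ (posPart_nonneg x)
  have h6 := hg _ (negPart_nonneg x)
  have h7 := hh _ (posPart_nonneg x)
  have h8 := hh _ (negPart_nonneg x)
  rw [neg_apply] at h3 h4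
  have e1 : f x = f x⁺ - f x⁻ := by rw [← map_sub, posPart_sub_negPart]
  rw [← posPart_add_negPart x, e1, map_add, add_apply, add_apply, abs_le]
  constructor <;> linarith

/-- With `g` positive and `|f y| ≤ g |y|`, one has `|f (S x)| ≤ g |S x| ≤ g (T |x|)`, and the moduli
of a disjoint bounded sequence are again disjoint and bounded. -/
theorem IsLMwc.of_le {G : Type*} [NormedAddCommGroup G] [NormedSpace ℝ G] [Lattice G]
    [IsOrderedAddMonoid G] [HasSolidNorm G] {S T : G →L[ℝ] E} (hT : IsLMwc T)
    (hS : IsPositiveOp S) (hST : ∀ x, 0 ≤ x → S x ≤ T x) : IsLMwc S := by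
  refine isLMwc_iff.mpr fun x hd hb f => ?_
  obtain ⟨g, hg, hfg⟩ := exists_dual_abs_le f
  have hb' : Bornology.IsBounded (Set.range fun n => |x n|) := by
    obtain ⟨M, hM⟩ := hb.exists_norm_le
    refine isBounded_iff_forall_norm_le.mpr ⟨M, ?_⟩
    rintro _ ⟨n, rfl⟩
    rw [norm_abs_eq_norm]
    exact hM _ ⟨n, rfl⟩
  refine squeeze_zero_norm (fun n => ?_) (isLMwc_iff.mp hT _ hd.abs hb' g)
  refine (hfg _).trans ?_
  rw [← sub_nonneg, ← map_sub]
  exact hg _ (sub_nonneg.mpr ((hS.abs_apply_le _).trans (hST _ (abs_nonneg _))))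

end PositivePart

/-! ### Spaces of differences of positive operators -/

section RegularIn

variable {E : Type*} [NormedAddCommGroup E] [NormedSpace ℝ E] [Lattice E]
  [IsOrderedAddMonoid E]

theorem IsPositiveOp.add {S T : E →L[ℝ] E} (hS : IsPositiveOp S) (hT : IsPositiveOp T) :
    IsPositiveOp (S + T) := fun x hx => add_nonneg (hS x hx) (hT x hx)

theorem IsPositiveOp.comp {S T : E →L[ℝ] E} (hS : IsPositiveOp S) (hT : IsPositiveOp T) :
    IsPositiveOp (S.comp T) := fun x hx => hS _ (hT x hx)

theorem IsPositiveOp.smul [IsOrderedModule ℝ E] {T : E →L[ℝ] E} (hT : IsPositiveOp T) {c : ℝ}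
    (hc : 0 ≤ c) : IsPositiveOp (c • T) := fun x hx => smul_nonneg hc (hT x hx)

theorem isPositiveOp_zero : IsPositiveOp (0 : E →L[ℝ] E) := fun _ _ => le_rfl

variable [IsOrderedModule ℝ E]

/-- The non-unital subalgebra of `L_r(E)` of the differences of positive operators from a class
stable under sums, non-negative multiples and products. -/
def regularInSubalgebra (P : Set (E →L[ℝ] E)) (h0 : 0 ∈ P)
    (hadd : ∀ S ∈ P, ∀ T ∈ P, S + T ∈ P) (hsmul : ∀ c : ℝ, 0 ≤ c → ∀ T ∈ P, c • T ∈ P)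
    (hmul : ∀ S ∈ P, ∀ T ∈ P, S.comp T ∈ P) : NonUnitalSubalgebra ℝ (RegOp E) where
  carrier := {T | IsRegularIn P T.toOp}
  zero_mem' := ⟨0, h0, 0, h0, isPositiveOp_zero, isPositiveOp_zero, by simp⟩
  add_mem' := by
    rintro S T ⟨A, hA, B, hB, pA, pB, hS⟩ ⟨C, hC, D, hD, pC, pD, hT⟩
    refine ⟨A + C, hadd _ hA _ hC, B + D, hadd _ hB _ hD, pA.add pC, pB.add pD, ?_⟩
    rw [RegOp.toOp_add, hS, hT]
    abel
  mul_mem' := by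
    rintro S T ⟨A, hA, B, hB, pA, pB, hS⟩ ⟨C, hC, D, hD, pC, pD, hT⟩
    refine ⟨A.comp C + B.comp D, hadd _ (hmul _ hA _ hC) _ (hmul _ hB _ hD),
      A.comp D + B.comp C, hadd _ (hmul _ hA _ hD) _ (hmul _ hB _ hC),
      (pA.comp pC).add (pB.comp pD), (pA.comp pD).add (pB.comp pC), ?_⟩
    rw [RegOp.toOp_mul, hS, hT, ContinuousLinearMap.sub_comp, ContinuousLinearMap.comp_sub,
      ContinuousLinearMap.comp_sub]
    abel
  smul_mem' := by
    rintro c T ⟨A, hA, B, hB, pA, pB, hT⟩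
    rcases le_total 0 c with hc | hc
    · refine ⟨c • A, hsmul c hc _ hA, c • B, hsmul c hc _ hB, pA.smul hc, pB.smul hc, ?_⟩
      rw [RegOp.toOp_smul, hT, smul_sub]
    · have hc' := neg_nonneg.mpr hc
      refine ⟨-c • B, hsmul _ hc' _ hB, -c • A, hsmul _ hc' _ hA, pB.smul hc', pA.smul hc', ?_⟩
      rw [RegOp.toOp_smul, hT, ← smul_sub, ← neg_sub A B, neg_smul_neg]

end RegularIn

/-! ### The Banach lattice of regular operators -/

namespace RegOp

section Lattice

variable {E : Type*} [NormedAddCommGroup E] [NormedSpace ℝ E] [Lattice E]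
  [IsOrderedAddMonoid E] [IsOrderedModule ℝ E]

/-- A positive operator, as a regular operator. -/
def ofPositive (T : E →L[ℝ] E) (hT : IsPositiveOp T) : RegOp E :=
  ⟨T, T, trivial, 0, trivial, hT, isPositiveOp_zero, (sub_zero T).symm⟩

theorem isPositiveOp_of_mem_dominants {T : RegOp E} {S : E →L[ℝ] E} (hS : S ∈ dominants T) :
    IsPositiveOp S := fun x hx => by
  obtain ⟨h1, h2⟩ := hS x hx
  -- Adding `T x ≤ S x` and `-T x ≤ S x` gives `0 ≤ 2 S x`.
  have h3 := add_le_add h1 h2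
  rw [add_neg_cancel] at h3
  have h4 : (0 : E) ≤ (2 : ℝ)⁻¹ • (S x + S x) := smul_nonneg (by norm_num) h3
  rwa [← two_smul ℝ, inv_smul_smul₀ two_ne_zero] at h4

variable [HasSolidNorm E]

/-- Positive parts suffice for a lattice, since `S ⊔ T = S + (T - S)⁺`. In a splitting `T = A - B`
the operator `A` is the positive majorant that Riesz–Kantorovich needs. -/
theorem exists_isLUB_zero (hE : IsDedekindComplete E) (T : RegOp E) :
    ∃ P : RegOp E, IsLUB {T, 0} P := by
  obtain ⟨A, -, B, -, hA, hB, hT⟩ := T.2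
  obtain ⟨P, hP⟩ := exists_continuousLinearMap_isLUB hE (T := toOp T) hA fun x hx => by
    change T.1 x ≤ A x
    rw [hT]
    exact sub_le_self _ (hB x hx)
  have hP0 : IsPositiveOp P := fun x hx => (hP x hx).1 ⟨0, ⟨le_rfl, hx⟩, map_zero _⟩
  refine ⟨ofPositive P hP0, ?_, fun R hR x hx => (hP x hx).2 ?_⟩
  · rintro _ (rfl | rfl)
    · exact fun x hx => (hP x hx).1 ⟨x, ⟨hx, le_rfl⟩, rfl⟩
    · exact hP0
  · rintro _ ⟨y, ⟨hy, hyx⟩, rfl⟩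
    have h1 : T ≤ R := hR (Or.inl rfl)
    have h2 : (0 : RegOp E) ≤ R := hR (Or.inr rfl)
    refine (h1 y hy).trans ?_
    rw [← sub_nonneg, ← map_sub]
    exact h2 _ (sub_nonneg.mpr hyx)

/-- The vector lattice structure of `L_r(E)` for Dedekind complete `E`. -/
@[reducible] noncomputable def latticeOfIsDedekindComplete (hE : IsDedekindComplete E) :
    Lattice (RegOp E) where
  __ := (inferInstance : PartialOrder (RegOp E))
  sup S T := S + (exists_isLUB_zero hE (T - S)).choose
  inf S T := S - (exists_isLUB_zero hE (S - T)).choose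
  le_sup_left S T :=
    le_add_of_nonneg_right ((exists_isLUB_zero hE (T - S)).choose_spec.1 (Or.inr rfl))
  le_sup_right S T :=
    sub_le_iff_le_add'.mp ((exists_isLUB_zero hE (T - S)).choose_spec.1 (Or.inl rfl))
  sup_le S T R hS hT := by
    rw [← le_sub_iff_add_le']
    refine (exists_isLUB_zero hE (T - S)).choose_spec.2 ?_
    rintro _ (rfl | rfl)
    · exact sub_le_sub_right hT S
    · exact sub_nonneg.mpr hS
  inf_le_left S T :=
    sub_le_self _ ((exists_isLUB_zero hE (S - T)).choose_spec.1 (Or.inr rfl))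
  inf_le_right S T :=
    sub_le_comm.mp ((exists_isLUB_zero hE (S - T)).choose_spec.1 (Or.inl rfl))
  le_inf R S T hS hT := by
    rw [le_sub_comm]
    refine (exists_isLUB_zero hE (S - T)).choose_spec.2 ?_
    rintro _ (rfl | rfl)
    · exact sub_le_sub_left hT S
    · exact sub_nonneg.mpr hS

theorem mem_dominants_iff {T : RegOp E} {S : E →L[ℝ] E} (hS : IsPositiveOp S) :
    S ∈ dominants T ↔ T ≤ ofPositive S hS ∧ -T ≤ ofPositive S hS :=
  ⟨fun h => ⟨fun x hx => (h x hx).1, fun x hx => (h x hx).2⟩,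
    fun h x hx => ⟨h.1 x hx, h.2 x hx⟩⟩

/-- Consequently the regular norm of `T` depends only on `|T|` and is monotone in it. -/
theorem mem_dominants_iff_abs_le (hE : IsDedekindComplete E) {T : RegOp E} {S : E →L[ℝ] E}
    (hS : IsPositiveOp S) :
    letI := latticeOfIsDedekindComplete hE
    S ∈ dominants T ↔ |T| ≤ ofPositive S hS := by
  let := latticeOfIsDedekindComplete hE
  exact (mem_dominants_iff hS).trans abs_le'.symm

theorem dominants_subset_of_abs_le_abs (hE : IsDedekindComplete E) {S T : RegOp E}
    (h : letI := latticeOfIsDedekindComplete hE; |S| ≤ |T|) : dominants T ⊆ dominants S :=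
  fun R hR => by
    let := latticeOfIsDedekindComplete hE
    have hR' := isPositiveOp_of_mem_dominants hR
    rw [mem_dominants_iff_abs_le hE hR'] at hR ⊢
    exact le_trans h hR

theorem hasSolidNorm (hE : IsDedekindComplete E) :
    @HasSolidNorm (RegOp E) instNormedAddCommGroup (latticeOfIsDedekindComplete hE) := by
  let := latticeOfIsDedekindComplete hE
  exact ⟨fun S T h => le_norm_of_forall fun R hR =>
    norm_le_of_mem (dominants_subset_of_abs_le_abs hE h hR)⟩

end Lattice

/-! ### Completeness of the regular norm; solidity and closedness of r-`P`-operators -/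

section Complete

variable {E : Type*} [NormedAddCommGroup E] [NormedSpace ℝ E] [Lattice E]
  [IsOrderedAddMonoid E] [IsOrderedModule ℝ E] [HasSolidNorm E]

theorem isPositiveOp_of_hasSum {A : ℕ → E →L[ℝ] E} {B : E →L[ℝ] E} (hA : ∀ n, IsPositiveOp (A n))
    (h : HasSum A B) : IsPositiveOp B := fun x hx =>
  (h.mapL (ContinuousLinearMap.apply ℝ E x)).nonneg fun n => hA n x hx

theorem toOp_sum (u : ℕ → RegOp E) (s : Finset ℕ) :
    toOp (∑ i ∈ s, u i) = ∑ i ∈ s, toOp (u i) :=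
  map_sum (AddMonoidHom.mk' (toOp (E := E)) toOp_add) u s

theorem continuous_toOp : Continuous (toOp (E := E)) :=
  AddMonoidHomClass.continuous_of_bound (AddMonoidHom.mk' (toOp (E := E)) toOp_add) 1
    fun T => by simpa using norm_toOp_le T

/-- Absolutely summable series are shown to converge. Dominants `S n` of nearly minimal norm are
themselves absolutely summable, and since the positive cone is closed, each tail of `∑ S n`
dominates the corresponding tail of `∑ u n`. Its operator norm therefore bounds the regular norm of
the remainder. -/
instance instCompleteSpace [CompleteSpace E] : CompleteSpace (RegOp E) := by
  refine NormedAddCommGroup.completeSpace_of_summable_imp_tendsto fun u hu => ?_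
  -- The infimum defining the norm need not be attained; the geometric slack keeps the norms
  -- summable.
  have hex : ∀ n, ∃ S ∈ dominants (u n), ‖S‖ < ‖u n‖ + (1 / 2 : ℝ) ^ n := fun n => by
    by_contra! h
    have := le_norm_of_forall h
    linarith [pow_pos (one_half_pos (α := ℝ)) n]
  choose S hSd hS using hex
  have hSn : Summable fun n => ‖S n‖ :=
    Summable.of_nonneg_of_le (fun n => norm_nonneg _) (fun n => (hS n).le)
      (hu.add summable_geometric_two)
  have hsS := hSn.of_norm.hasSum
  have hsu : HasSum (fun n => toOp (u n)) (∑' n, toOp (u n)) :=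
    (Summable.of_norm_bounded hu fun n => norm_toOp_le (u n)).hasSum
  set B := ∑' n, S n
  set T := ∑' n, toOp (u n)
  have hsub : ∀ n, IsPositiveOp (S n - toOp (u n)) := fun n x hx =>
    sub_nonneg.mpr (hSd n x hx).1
  have hadd : ∀ n, IsPositiveOp (S n + toOp (u n)) := fun n x hx =>
    neg_le_iff_add_nonneg.mp (hSd n x hx).2
  -- The limit is regular because `T = B - (B - T)`, where `B` and `B - T = ∑ (S n - u n)` are
  -- positive.
  let T' : RegOp E := ⟨T, B, trivial, B - T, trivial,
    isPositiveOp_of_hasSum (fun n => isPositiveOp_of_mem_dominants (hSd n)) hsS,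
    isPositiveOp_of_hasSum hsub (hsS.sub hsu), (sub_sub_cancel B T).symm⟩
  have hT' : toOp T' = T := rfl
  refine ⟨T', ?_⟩
  rw [tendsto_iff_norm_sub_tendsto_zero]
  have hlim : Tendsto (fun n => ‖B - ∑ i ∈ Finset.range n, S i‖) atTop (𝓝 0) := by
    simpa using (hsS.tendsto_sum_nat.const_sub B).norm
  refine squeeze_zero (fun n => norm_nonneg _) (fun n => ?_) hlim
  rw [norm_sub_rev]
  have h1 := (hasSum_nat_add_iff' n).mpr (hsS.sub hsu)
  have h2 := (hasSum_nat_add_iff' n).mpr (hsS.add hsu)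
  have p1 := isPositiveOp_of_hasSum (fun i => hsub (i + n)) h1
  have p2 := isPositiveOp_of_hasSum (fun i => hadd (i + n)) h2
  rw [Finset.sum_sub_distrib, sub_sub_sub_comm] at p1
  rw [Finset.sum_add_distrib, add_sub_add_comm] at p2
  refine norm_le_of_mem fun x hx => ?_
  rw [toOp_sub, hT', toOp_sum]
  exact ⟨sub_nonneg.mp (p1 x hx), neg_le_iff_add_nonneg.mpr (p2 x hx)⟩

theorem isRegOpBanachLattice [CompleteSpace E] (hE : IsDedekindComplete E) :
    IsRegOpBanachLattice (latticeOfIsDedekindComplete hE) :=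
  ⟨rfl, hasSolidNorm hE, inferInstance⟩

/-- If `P` is stable under sums and dominated positive operators, then the r-`P`-operators are
those with modulus in `P`. -/
theorem isRegularIn_iff_abs_mem (hE : IsDedekindComplete E) {P : Set (E →L[ℝ] E)}
    (hadd : ∀ S ∈ P, ∀ T ∈ P, S + T ∈ P)
    (hle : ∀ T ∈ P, ∀ S, IsPositiveOp S → (∀ x, 0 ≤ x → S x ≤ T x) → S ∈ P) (T : RegOp E) :
    letI := latticeOfIsDedekindComplete hE
    IsRegularIn P (toOp T) ↔ toOp |T| ∈ P := by
  let := latticeOfIsDedekindComplete hE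
  constructor
  · rintro ⟨A, hA, B, hB, pA, pB, hT⟩
    have hd : A + B ∈ dominants T := fun x hx => by
      have h1 := pA x hx
      have h2 := pB x hx
      rw [hT]
      change A x - B x ≤ A x + B x ∧ -(A x - B x) ≤ A x + B x
      refine ⟨(sub_le_self _ h2).trans (le_add_of_nonneg_right h2), ?_⟩
      rw [neg_sub]
      exact (sub_le_self _ h1).trans (le_add_of_nonneg_left h1)
    rw [mem_dominants_iff_abs_le hE (pA.add pB)] at hd
    exact hle _ (hadd _ hA _ hB) _ (abs_nonneg T) hd
  · intro h
    refine ⟨toOp T⁺, hle _ h _ (posPart_nonneg T) ?_, toOp T⁻, hle _ h _ (negPart_nonneg T) ?_,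
      posPart_nonneg T, negPart_nonneg T, ?_⟩
    · exact (sup_le (le_abs_self T) (abs_nonneg T) : T⁺ ≤ |T|)
    · exact (sup_le (neg_le_abs T) (abs_nonneg T) : T⁻ ≤ |T|)
    · rw [← toOp_sub, posPart_sub_negPart]

theorem isSolid_setOf_isRegularIn (hE : IsDedekindComplete E) {P : Set (E →L[ℝ] E)}
    (hadd : ∀ S ∈ P, ∀ T ∈ P, S + T ∈ P)
    (hle : ∀ T ∈ P, ∀ S, IsPositiveOp S → (∀ x, 0 ≤ x → S x ≤ T x) → S ∈ P) :
    letI := latticeOfIsDedekindComplete hE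
    LatticeOrderedAddCommGroup.IsSolid {T : RegOp E | IsRegularIn P (toOp T)} := by
  let := latticeOfIsDedekindComplete hE
  intro T hT S hST
  change IsRegularIn P _ at hT
  change IsRegularIn P _
  rw [isRegularIn_iff_abs_mem hE hadd hle] at hT ⊢
  exact hle _ hT _ (abs_nonneg S) hST

theorem isClosed_setOf_isRegularIn (hE : IsDedekindComplete E) {P : Set (E →L[ℝ] E)}
    (hadd : ∀ S ∈ P, ∀ T ∈ P, S + T ∈ P)
    (hle : ∀ T ∈ P, ∀ S, IsPositiveOp S → (∀ x, 0 ≤ x → S x ≤ T x) → S ∈ P)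
    (hP : IsClosed P) : IsClosed {T : RegOp E | IsRegularIn P (toOp T)} := by
  let := latticeOfIsDedekindComplete hE
  have := hasSolidNorm hE
  -- In a solid norm the modulus is 1-Lipschitz.
  have hc : Continuous fun T : RegOp E => |T| :=
    continuous_iff_continuousAt.mpr fun T => tendsto_iff_norm_sub_tendsto_zero.mpr <|
      squeeze_zero (fun _ => norm_nonneg _) (fun S => norm_abs_sub_abs S T)
        (tendsto_iff_norm_sub_tendsto_zero.mp tendsto_id)
  simp only [isRegularIn_iff_abs_mem hE hadd hle]
  exact hP.preimage (continuous_toOp.comp hc)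

end Complete

end RegOp

/-! ### The algebras of r-l-Lwc and r-l-Mwc operators -/

section Main

variable (E : Type*) [NormedAddCommGroup E] [NormedSpace ℝ E] [Lattice E]
  [IsOrderedAddMonoid E] [IsOrderedModule ℝ E] [HasSolidNorm E]

/-- `r-l-Lwc(E)` as a subalgebra of `L_r(E)`. -/
def rLLwcSubalgebra : NonUnitalSubalgebra ℝ (RegOp E) :=
  regularInSubalgebra {S : E →L[ℝ] E | IsLLwc S} isLLwc_zero (fun _ hS _ hT => IsLLwc.add hS hT)
    (fun _ hc _ hT => IsLLwc.smul hT hc) (fun _ hS T _ => IsLLwc.comp hS T)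

/-- `r-l-Mwc(E)` as a subalgebra of `L_r(E)`. -/
def rLMwcSubalgebra : NonUnitalSubalgebra ℝ (RegOp E) :=
  regularInSubalgebra {S : E →L[ℝ] E | IsLMwc S} isLMwc_zero (fun _ hS _ hT => IsLMwc.add hS hT)
    (fun c _ _ hT => IsLMwc.smul hT c) (fun S _ _ hT => IsLMwc.comp_left hT S)

/-- The identity is regular, hence a difference of two l-Lwc operators and itself l-Lwc. Conversely
`A = id ∘ A` makes both positive parts of any regular splitting l-Lwc. -/
theorem rLLwc_eq_univ_iff : rLLwc E = Set.univ ↔ IsLLwc (ContinuousLinearMap.id ℝ E) := by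
  constructor
  · intro h
    obtain ⟨A, hA, B, hB, -, -, h1⟩ : (1 : RegOp E) ∈ rLLwc E := h ▸ Set.mem_univ _
    rw [RegOp.toOp_one] at h1
    rw [h1, sub_eq_add_neg]
    exact IsLLwc.add hA (IsLLwc.neg hB)
  · refine fun h => Set.eq_univ_of_forall fun T => ?_
    obtain ⟨A, -, B, -, pA, pB, hT⟩ := T.2
    exact ⟨A, h.comp A, B, h.comp B, pA, pB, hT⟩

theorem rLMwc_eq_univ_iff : rLMwc E = Set.univ ↔ IsLMwc (ContinuousLinearMap.id ℝ E) := by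
  constructor
  · intro h
    obtain ⟨A, hA, B, hB, -, -, h1⟩ : (1 : RegOp E) ∈ rLMwc E := h ▸ Set.mem_univ _
    rw [RegOp.toOp_one] at h1
    rw [h1, sub_eq_add_neg]
    exact IsLMwc.add hA (IsLMwc.neg hB)
  · refine fun h => Set.eq_univ_of_forall fun T => ?_
    obtain ⟨A, -, B, -, pA, pB, hT⟩ := T.2
    exact ⟨A, h.comp_left A, B, h.comp_left B, pA, pB, hT⟩

variable {E}

theorem isClosedOrderIdeal_rLLwc (hE : IsDedekindComplete E) :
    @IsClosedOrderIdeal (RegOp E) _ _ (RegOp.latticeOfIsDedekindComplete hE) (rLLwc E) :=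
  ⟨⟨(rLLwcSubalgebra E).toSubmodule, rfl⟩,
    RegOp.isSolid_setOf_isRegularIn hE (fun _ hS _ hT => IsLLwc.add hS hT)
      fun _ hT _ hS h => IsLLwc.of_le hT hS h,
    RegOp.isClosed_setOf_isRegularIn hE (fun _ hS _ hT => IsLLwc.add hS hT)
      (fun _ hT _ hS h => IsLLwc.of_le hT hS h) isClosed_setOf_isLLwc⟩

theorem isClosedOrderIdeal_rLMwc (hE : IsDedekindComplete E) :
    @IsClosedOrderIdeal (RegOp E) _ _ (RegOp.latticeOfIsDedekindComplete hE) (rLMwc E) :=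
  ⟨⟨(rLMwcSubalgebra E).toSubmodule, rfl⟩,
    RegOp.isSolid_setOf_isRegularIn hE (fun _ hS _ hT => IsLMwc.add hS hT)
      fun _ hT _ hS h => IsLMwc.of_le hT hS h,
    RegOp.isClosed_setOf_isRegularIn hE (fun _ hS _ hT => IsLMwc.add hS hT)
      (fun _ hT _ hS h => IsLMwc.of_le hT hS h) isClosed_setOf_isLMwc⟩

end Main

theorem theorem6 (E : Type*) [NormedAddCommGroup E] [NormedSpace ℝ E] [CompleteSpace E]
    [Lattice E] [IsOrderedAddMonoid E] [IsOrderedModule ℝ E] [HasSolidNorm E] :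
    (∃ A : NonUnitalSubalgebra ℝ (RegOp E), (A : Set (RegOp E)) = rLLwc E) ∧
    (∃ A : NonUnitalSubalgebra ℝ (RegOp E), (A : Set (RegOp E)) = rLMwc E) ∧
    (rLLwc E = Set.univ ↔ IsLLwc (ContinuousLinearMap.id ℝ E)) ∧
    (rLMwc E = Set.univ ↔ IsLMwc (ContinuousLinearMap.id ℝ E)) ∧
    (IsDedekindComplete E →
      ∃ L : Lattice (RegOp E), IsRegOpBanachLattice L ∧
        IsClosedOrderIdeal (rLLwc E) ∧ IsClosedOrderIdeal (rLMwc E)) :=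
  ⟨⟨rLLwcSubalgebra E, rfl⟩, ⟨rLMwcSubalgebra E, rfl⟩, rLLwc_eq_univ_iff E, rLMwc_eq_univ_iff E,
    fun hE => ⟨RegOp.latticeOfIsDedekindComplete hE, RegOp.isRegOpBanachLattice hE,
      isClosedOrderIdeal_rLLwc hE, isClosedOrderIdeal_rLMwc hE⟩⟩
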